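/- A ternary $[n,k,d]$ code is a $k$-dimensional subspace $C$ of $\mathbb{F}_3^n$ whose minimum weight (the least number of non-zero coordinates of a non-zero element of $C$) is exactly $d$. It is called LCD (linear complementary dual) if $C\cap C^{\perp}=\{0\}$, where $C^{\perp}=\{x\in\mathbb{F}_3^n : \sum_{i=1}^n x_iy_i=0 \text{ for all } y\in C\}$. **Corollary.** Let $$\mathcal{P}_3=\{(34,22,7),\,(37,23,7),\,(37,29,5),\,(40,30,5)\},$$ $$\mathcal{P}'_3=\{(34,21,7),\,(37,22,7),\,(37,28,5),\,(40,29,5)\}.$$ Suppose that $(n,k,d)\in\mathcal{P}_3\cup\mathcal{P}'_3$. Then for every integer $s\ge 0$ there is a ternary LCD $$\left[n+\frac{3^k-1}{2}\,s,\;k,\;d+3^{k-1}s\right]$$ code. -/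

import Mathlib

namespace LCDCode

/-- A linear code of length `n` over `F`: a vector subspace of `F ^ n`. -/
abbrev LinearCode (F : Type*) [Field F] (n : ℕ) : Type _ := Submodule F (Fin n → F)

/-- The (Euclidean) dual code, for the form `⟨x, y⟩ = ∑ i, x i * y i`. -/
def dual {F : Type*} [Field F] {n : ℕ} (C : LinearCode F n) : LinearCode F n where
  carrier := {x | ∀ y ∈ C, ∑ i, x i * y i = 0}
  add_mem' := by
    intro a b ha hb y hy
    simp only [Pi.add_apply, add_mul, Finset.sum_add_distrib, ha y hy, hb y hy, add_zero]
  zero_mem' := by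
    intro y _
    simp
  smul_mem' := by
    intro c x hx y hy
    simp only [Pi.smul_apply, smul_eq_mul, mul_assoc, ← Finset.mul_sum, hx y hy, mul_zero]

/-- Linear complementary dual codes: `C ∩ C^⊥ = {0}`. -/
def IsLCD {F : Type*} [Field F] {n : ℕ} (C : LinearCode F n) : Prop :=
  C ⊓ dual C = ⊥

/-- `C` has minimum weight `d`: the least number of non-zero coordinates of a non-zero codeword
exists and equals `d`. -/
def HasMinWeight {F : Type*} [Field F] [DecidableEq F] {n : ℕ} (C : LinearCode F n)
    (d : ℕ) : Prop :=
  IsLeast {w : ℕ | ∃ x ∈ C, x ≠ 0 ∧ w = hammingNorm x} d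

/-- There is an LCD `[n, k, d]` code over `F`. -/
def ExistsLCDCode (F : Type*) [Field F] [DecidableEq F] (n k d : ℕ) : Prop :=
  ∃ C : LinearCode F n, Module.finrank F C = k ∧ HasMinWeight C d ∧ IsLCD C

/-- The parameters `𝒫₃`. -/
def P3 : Finset (ℕ × ℕ × ℕ) :=
  {(34, 22, 7), (37, 23, 7), (37, 29, 5), (40, 30, 5)}

/-- The parameters `𝒫′₃`. -/
def P3' : Finset (ℕ × ℕ × ℕ) :=
  {(34, 21, 7), (37, 22, 7), (37, 28, 5), (40, 29, 5)}

end LCDCode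

namespace LCDCode

open Module

/-! Everything grows out of two explicit systematic LCD codes, [34,22,7] and [37,29,5]. Construction
X (`existsLCDCode_constructionX`) adjoins a suitable dual vector prolonged by 111 and gives
[37,23,7] and [40,30,5]. Since 7 and 5 are prime to 3, a minimum weight word is non-isotropic, and
`ExistsLCDCode.pred` cuts each code by a hyperplane through such a word; this gives the primed
parameters. For dimension at least 2 the simplex code has constant weight divisible by 3, so it is
self-orthogonal: appending copies of it (`ExistsLCDCode.add_simplex`) raises all weights equally and
leaves the inner products unchanged.

The explicit codes are certified by `existsLCDCode_systematic`. A word of weight at most 2(b+1)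
would split into two words of weight at most b+1 with opposite syndromes, so it is enough that the
small combinations of parity check columns are distinct up to sign. This is a finite check on
integer keys. -/

/-! ### Recognizing LCD codes. -/

theorem hammingNorm_eq_sum {F ι : Type*} [Zero F] [DecidableEq F] [Fintype ι] (x : ι → F) :
    hammingNorm x = ∑ i, if x i = 0 then 0 else 1 := by
  rw [hammingNorm, Finset.card_filter]
  exact Finset.sum_congr rfl fun i _ => by by_cases h : x i = 0 <;> simp [h]

/-- Nondegeneracy of the form pulled back along `φ` yields both injectivity (hence the dimension)
and the LCD property. Arbitrary `V` and `ι` allow product spaces and disjoint unions of coordinates.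
-/
theorem existsLCDCode_of_linearMap {F : Type*} [Field F] [DecidableEq F] {V ι : Type*}
    [AddCommGroup V] [Module F V] [Fintype ι] {n k d : ℕ} (φ : V →ₗ[F] ι → F)
    (hn : Fintype.card ι = n) (hk : finrank F V = k)
    (hd : ∀ v ≠ 0, d ≤ hammingNorm (φ v)) (hd' : ∃ v ≠ 0, hammingNorm (φ v) = d)
    (hφ : ∀ v, (∀ w, φ v ⬝ᵥ φ w = 0) → v = 0) : ExistsLCDCode F n k d := by
  let e : Fin n ≃ ι := (Fintype.equivFinOfCardEq hn).symm
  let ψ : V →ₗ[F] Fin n → F := (LinearMap.funLeft F F e).comp φ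
  have hnorm : ∀ v, hammingNorm (ψ v) = hammingNorm (φ v) := by
    intro v
    rw [hammingNorm_eq_sum, hammingNorm_eq_sum]
    exact e.sum_comp fun j => if φ v j = 0 then 0 else 1
  have hdot : ∀ v w, ∑ i, ψ v i * ψ w i = φ v ⬝ᵥ φ w := fun v w =>
    e.sum_comp fun j => φ v j * φ w j
  have hker : ∀ v, ψ v = 0 → v = 0 := fun v hv => hφ v fun w => by
    rw [← hdot, hv]; simp
  have hinj : Function.Injective ψ := (injective_iff_map_eq_zero ψ).2 hker
  refine ⟨LinearMap.range ψ, ?_, ⟨?_, ?_⟩, ?_⟩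
  · rw [LinearMap.finrank_range_of_inj hinj, hk]
  · obtain ⟨v, hv, hvd⟩ := hd'
    exact ⟨ψ v, ⟨v, rfl⟩, fun h => hv (hker v h), by rw [hnorm, hvd]⟩
  · rintro w ⟨_, ⟨v, rfl⟩, hv, rfl⟩
    rw [hnorm]
    exact hd v fun h => hv (by rw [h, map_zero])
  · rw [IsLCD, eq_bot_iff]
    rintro _ ⟨⟨v, rfl⟩, hv⟩
    rw [Submodule.mem_bot, hφ v fun w => ?_, map_zero]
    rw [← hdot]
    exact hv _ ⟨w, rfl⟩

theorem IsLCD.eq_zero {F : Type*} [Field F] {n : ℕ} {C : LinearCode F n} (hC : IsLCD C)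
    {x : Fin n → F} (hx : x ∈ C) (h : ∀ y ∈ C, x ⬝ᵥ y = 0) : x = 0 := by
  have : x ∈ C ⊓ dual C := ⟨hx, h⟩
  rwa [hC, Submodule.mem_bot] at this

/-- Non-zero squares in `ZMod 3` equal 1. -/
theorem dotProduct_self_eq_hammingNorm {ι : Type*} [Fintype ι] (x : ι → ZMod 3) :
    x ⬝ᵥ x = (hammingNorm x : ZMod 3) := by
  have h : ∀ a : ZMod 3, a * a = if a = 0 then 0 else 1 := by decide
  rw [hammingNorm_eq_sum, dotProduct, Nat.cast_sum]
  exact Finset.sum_congr rfl fun i _ => by rw [h]; split_ifs <;> simp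

theorem natCast_zmod_three_ne_zero {d : ℕ} (hd : ¬ 3 ∣ d) : (d : ZMod 3) ≠ 0 := fun h =>
  hd ((ZMod.natCast_eq_zero_iff d 3).1 h)

/-! ### New LCD codes from old: subcodes, construction X, simplex codes. -/

/-- A ternary LCD code whose minimum weight is prime to `3` contains an LCD code of codimension
one with the same minimum weight. -/
theorem ExistsLCDCode.pred {n k d : ℕ} (h : ExistsLCDCode (ZMod 3) n (k + 1) d) (hk : k ≠ 0)
    (hd : ¬ 3 ∣ d) : ExistsLCDCode (ZMod 3) n k d := by
  obtain ⟨C, hdim, ⟨⟨w, hwC, hw0, hwd⟩, hmin⟩, hC⟩ := h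
  have hww : w ⬝ᵥ w ≠ 0 := by
    rw [dotProduct_self_eq_hammingNorm, ← hwd]
    exact natCast_zmod_three_ne_zero hd
  -- A non-isotropic `v` splits `C` orthogonally as its span plus `C ∩ v^⊥`, so the form stays
  -- nondegenerate on `C ∩ v^⊥`.
  have hdecomp : ∀ (v : Fin n → ZMod 3), v ∈ C → v ⬝ᵥ v ≠ 0 → ∀ x ∈ C, v ⬝ᵥ x = 0 →
      (∀ y ∈ C, v ⬝ᵥ y = 0 → x ⬝ᵥ y = 0) → x = 0 := by
    intro v hv hvv x hx hvx hxy
    refine hC.eq_zero hx fun y hy => ?_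
    have hz : y - ((v ⬝ᵥ y) / (v ⬝ᵥ v)) • v ∈ C := C.sub_mem hy (C.smul_mem _ hv)
    have := hxy _ hz (by rw [dotProduct_sub, dotProduct_smul, smul_eq_mul, div_mul_cancel₀ _ hvv,
      sub_self])
    rwa [dotProduct_sub, dotProduct_smul, dotProduct_comm x v, hvx, smul_zero, sub_zero] at this
  have hker : ∀ v ∈ C, v ⬝ᵥ v ≠ 0 →
      finrank (ZMod 3) (LinearMap.ker ((dotProductBilin (ZMod 3) (ZMod 3) v).comp C.subtype)) = k := by
    intro v hv hvv
    have h1 := LinearMap.finrank_range_add_finrank_ker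
      ((dotProductBilin (ZMod 3) (ZMod 3) v).comp C.subtype)
    have h2 : LinearMap.range ((dotProductBilin (ZMod 3) (ZMod 3) v).comp C.subtype) = ⊤ :=
      LinearMap.range_eq_top.2 (LinearMap.surjective fun h0 =>
        hvv (by simpa using LinearMap.congr_fun h0 ⟨v, hv⟩))
    rw [h2, finrank_top, finrank_self, hdim] at h1
    omega
  obtain ⟨v, hvC, hwv, hvv⟩ : ∃ v ∈ C, w ⬝ᵥ v = 0 ∧ v ⬝ᵥ v ≠ 0 := by
    -- Otherwise all of `C ∩ w^⊥` is isotropic. As 2 is invertible, polarization makes the form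
    -- vanish on this space, which is non-zero because `k ≠ 0`; this contradicts `hdecomp w`.
    by_contra! hno
    have hpos := hker w hwC hww
    have : Nontrivial (LinearMap.ker ((dotProductBilin (ZMod 3) (ZMod 3) w).comp C.subtype)) :=
      nontrivial_of_finrank_pos (R := ZMod 3) (by omega)
    obtain ⟨⟨⟨x, hxC⟩, hx⟩, hx0⟩ := exists_ne
      (0 : LinearMap.ker ((dotProductBilin (ZMod 3) (ZMod 3) w).comp C.subtype))
    have hwx : w ⬝ᵥ x = 0 := by simpa using hx
    refine hx0 (Subtype.ext (Subtype.ext (hdecomp w hwC hww x hxC hwx fun y hy hwy => ?_)))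
    have h1 := hno (x + y) (C.add_mem hxC hy) (by rw [dotProduct_add, hwx, hwy, add_zero])
    rw [add_dotProduct, dotProduct_add, dotProduct_add, hno x hxC hwx, hno y hy hwy,
      dotProduct_comm y x] at h1
    generalize x ⬝ᵥ y = t at h1
    revert h1 t
    decide
  refine existsLCDCode_of_linearMap (C.subtype.comp (LinearMap.ker
    ((dotProductBilin (ZMod 3) (ZMod 3) v).comp C.subtype)).subtype) (Fintype.card_fin n)
    (hker v hvC hvv) ?_ ?_ ?_
  · rintro ⟨⟨x, hxC⟩, hx⟩ hx0
    exact hmin ⟨x, hxC, fun h => hx0 (Subtype.ext (Subtype.ext h)), rfl⟩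
  · refine ⟨⟨⟨w, hwC⟩, by simpa [dotProduct_comm] using hwv⟩, fun h => hw0 ?_, hwd.symm⟩
    simpa using h
  · rintro ⟨⟨x, hxC⟩, hx⟩ h
    refine Subtype.ext (Subtype.ext (hdecomp v hvC hvv x hxC (by simpa using hx) ?_))
    intro y hy hvy
    exact h ⟨⟨y, hy⟩, by simpa using hvy⟩

theorem hammingNorm_sumElim {F ι κ : Type*} [Zero F] [DecidableEq F] [Fintype ι] [Fintype κ]
    (x : ι → F) (y : κ → F) : hammingNorm (Sum.elim x y) = hammingNorm x + hammingNorm y := by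
  rw [hammingNorm_eq_sum, Fintype.sum_sum_type, hammingNorm_eq_sum x, hammingNorm_eq_sum y]
  rfl

/-- Construction X with the repetition code of length three: an LCD code is enlarged by a
non-isotropic vector of its dual, prolonged by `111`. -/
theorem existsLCDCode_constructionX {n k d : ℕ} {C : LinearCode (ZMod 3) n}
    (hdim : finrank (ZMod 3) C = k) (hmin : HasMinWeight C d) (hC : IsLCD C)
    {w : Fin n → ZMod 3} (hw : w ∈ dual C) (hww : w ⬝ᵥ w ≠ 0)
    (hdist : ∀ x ∈ C, d ≤ hammingNorm (x + w) + 3) :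
    ExistsLCDCode (ZMod 3) (n + 3) (k + 1) d := by
  let φ : C × ZMod 3 →ₗ[ZMod 3] Fin n ⊕ Fin 3 → ZMod 3 :=
    { toFun := fun p => Sum.elim ((p.1 : Fin n → ZMod 3) + p.2 • w) fun _ => p.2
      map_add' := by
        rintro ⟨x, s⟩ ⟨y, t⟩
        ext (i | i) <;> simp [add_mul]
        ring
      map_smul' := by
        rintro c ⟨x, s⟩
        ext (i | i) <;> simp [mul_add, mul_assoc] }
  have hwC : ∀ x ∈ C, w ⬝ᵥ x = 0 := hw
  have hdot : ∀ p q : C × ZMod 3, φ p ⬝ᵥ φ q =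
      (p.1 : Fin n → ZMod 3) ⬝ᵥ (q.1 : Fin n → ZMod 3) + p.2 * q.2 * (w ⬝ᵥ w) := by
    rintro ⟨⟨x, hx⟩, s⟩ ⟨⟨y, hy⟩, t⟩
    -- The tail 111 is self-orthogonal, so it does not affect the inner products.
    have h3 : (3 : ZMod 3) = 0 := rfl
    simp only [φ, LinearMap.coe_mk, AddHom.coe_mk, sumElim_dotProduct_sumElim, add_dotProduct,
      dotProduct_add, smul_dotProduct, dotProduct_smul, hwC x hx, hwC y hy,
      dotProduct_comm x w, smul_eq_mul, mul_zero, add_zero, zero_add]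
    simp only [dotProduct, Finset.sum_const, Finset.card_univ, Fintype.card_fin, nsmul_eq_mul,
      Nat.cast_ofNat, h3, zero_mul, add_zero]
    ring
  refine existsLCDCode_of_linearMap φ (by simp) (by simp [hdim]) ?_ ?_ ?_
  · rintro ⟨⟨x, hx⟩, t⟩ hne
    simp only [φ, LinearMap.coe_mk, AddHom.coe_mk, hammingNorm_sumElim]
    by_cases ht : t = 0
    · subst ht
      have hx0 : x ≠ 0 := by
        rintro rfl
        exact hne rfl
      simpa using (hmin.2 ⟨x, hx, hx0, rfl⟩ : d ≤ hammingNorm x).trans (Nat.le_add_right _ _)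
    · have h3 : hammingNorm (fun _ : Fin 3 => t) = 3 := by
        simp [hammingNorm, ht]
      -- Multiplication by `t` preserves weight and reduces `x + t • w` to the case of coefficient
      -- 1.
      have h1 := hdist (t⁻¹ • x) (C.smul_mem _ hx)
      rw [← hammingNorm_smul (k := t) (fun _ => IsSMulRegular.of_ne_zero ht)] at h1
      rw [smul_add, smul_smul, mul_inv_cancel₀ ht, one_smul] at h1
      rwa [h3]
  · obtain ⟨⟨x, hx, hx0, hxd⟩, -⟩ := hmin
    refine ⟨(⟨x, hx⟩, 0), fun h => hx0 (congrArg (fun p => (p.1 : Fin n → ZMod 3)) h), ?_⟩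
    simp only [φ, LinearMap.coe_mk, AddHom.coe_mk, hammingNorm_sumElim, hxd]
    simp [hammingNorm]
  · rintro ⟨⟨x, hx⟩, t⟩ h
    have hx0 : x = 0 := hC.eq_zero hx fun y hy => by simpa [hdot] using h (⟨y, hy⟩, 0)
    have ht : t = 0 := by simpa [hdot, hww] using h (0, 1)
    subst hx0 ht
    rfl

/-- A finite group without involutions is, up to zero, the disjoint union of a set and its
negative. -/
theorem exists_half_system (G : Type*) [AddCommGroup G] [Fintype G] [DecidableEq G]
    (hG : ∀ g : G, g = -g → g = 0) :
    ∃ H : Finset G, ∀ p : G → Prop, [DecidablePred p] → (∀ g, p (-g) ↔ p g) →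
      2 * (H.filter p).card = (Finset.univ.filter fun g => g ≠ 0 ∧ p g).card := by
  let e := Fintype.equivFin G
  -- An arbitrary enumeration selects the earlier member of each pair `g`, `-g`.
  refine ⟨Finset.univ.filter fun g => e g < e (-g), fun p _ hp => ?_⟩
  have hneg : (Finset.univ.filter fun g => e g < e (-g) ∧ p g).card =
      (Finset.univ.filter fun g => e (-g) < e g ∧ p g).card :=
    Finset.card_bij (fun g _ => -g) (by simp [hp]) (fun a _ b _ h => neg_injective h)
      fun b hb => ⟨-b, by simpa [hp] using hb, neg_neg b⟩
  have hunion : (Finset.univ.filter fun g => g ≠ 0 ∧ p g) =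
      (Finset.univ.filter fun g => e g < e (-g) ∧ p g) ∪
        Finset.univ.filter fun g => e (-g) < e g ∧ p g := by
    ext g
    have : g ≠ 0 ↔ e g < e (-g) ∨ e (-g) < e g := by
      rw [← ne_iff_lt_or_gt, e.injective.ne_iff, not_iff_not]
      exact ⟨fun h => by simp [h], hG g⟩
    simp only [Finset.mem_filter, Finset.mem_univ, true_and, Finset.mem_union, this, or_and_right]
  rw [Finset.filter_filter, hunion, Finset.card_union_of_disjoint, ← hneg, two_mul]
  rw [Finset.disjoint_filter]
  exact fun g _ h h' => lt_asymm h.1 h'.1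

/-- The functionals killing `v` form a hyperplane of the dual, leaving 3^(k+1) - 3^k others. Half of
this is the constant weight of the simplex code. -/
theorem card_dual_apply_ne_zero {V : Type*} [AddCommGroup V] [Module (ZMod 3) V]
    [Module.Finite (ZMod 3) V] [Fintype (Dual (ZMod 3) V)] {k : ℕ}
    (hk : finrank (ZMod 3) V = k + 1) {v : V} (hv : v ≠ 0) :
    (Finset.univ.filter fun f : Dual (ZMod 3) V => f v ≠ 0).card = 2 * 3 ^ k := by
  classical
  have hsurj : LinearMap.range (Dual.eval (ZMod 3) V v) = ⊤ :=
    LinearMap.range_eq_top.2 (LinearMap.surjective fun h0 =>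
      hv ((forall_dual_apply_eq_zero_iff (ZMod 3) v).1 fun f => LinearMap.congr_fun h0 f))
  have hrank := LinearMap.finrank_range_add_finrank_ker (Dual.eval (ZMod 3) V v)
  rw [hsurj, finrank_top, finrank_self, Subspace.dual_finrank_eq, hk] at hrank
  have hker : (Finset.univ.filter fun f : Dual (ZMod 3) V => f v = 0).card = 3 ^ k := by
    rw [← Fintype.card_subtype]
    have h1 := Module.card_eq_pow_finrank (K := ZMod 3) (V := LinearMap.ker (Dual.eval (ZMod 3) V v))
    rw [ZMod.card, show finrank (ZMod 3) (LinearMap.ker (Dual.eval (ZMod 3) V v)) = k by omega] at h1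
    rw [← h1]
    exact Fintype.card_congr (Equiv.subtypeEquivRight fun f => Iff.rfl)
  have hall : Fintype.card (Dual (ZMod 3) V) = 3 ^ (k + 1) := by
    rw [Module.card_eq_pow_finrank (K := ZMod 3), ZMod.card, Subspace.dual_finrank_eq, hk]
  have hsum := Finset.card_filter_add_card_filter_not (s := (Finset.univ : Finset (Dual (ZMod 3) V)))
    (fun f => f v = 0)
  rw [hker, Finset.card_univ, hall, pow_succ] at hsum
  simp only [ne_eq]
  omega

/-- Juxtaposition with `s` copies of the ternary simplex code. -/
theorem ExistsLCDCode.add_simplex {n k d : ℕ} (h : ExistsLCDCode (ZMod 3) n k d) (hk : 2 ≤ k)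
    (s : ℕ) : ExistsLCDCode (ZMod 3) (n + (3 ^ k - 1) / 2 * s) k (d + 3 ^ (k - 1) * s) := by
  classical
  obtain ⟨C, hdim, ⟨⟨w, hwC, hw0, hwd⟩, hmin⟩, hC⟩ := h
  -- The simplex weight 3^(k-1) becomes 3^(m+1), visibly divisible by 3.
  obtain ⟨m, rfl⟩ : ∃ m, k = m + 2 := ⟨k - 2, by omega⟩
  have : Finite (Dual (ZMod 3) C) := Module.finite_of_finite (ZMod 3)
  have : Fintype (Dual (ZMod 3) C) := Fintype.ofFinite _
  obtain ⟨H, hH⟩ := exists_half_system (Dual (ZMod 3) C) fun f hf => by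
    ext x
    have h3 : ∀ a : ZMod 3, a = -a → a = 0 := by decide
    exact h3 _ (LinearMap.congr_fun hf x)
  have hHcard : H.card = (3 ^ (m + 2) - 1) / 2 := by
    have h1 := hH (fun _ => True) fun _ => Iff.rfl
    simp only [Finset.filter_true, and_true, Finset.filter_ne', Finset.card_erase_of_mem,
      Finset.mem_univ, Finset.card_univ] at h1
    rw [Module.card_eq_pow_finrank (K := ZMod 3), ZMod.card, Subspace.dual_finrank_eq, hdim] at h1
    omega
  -- The simplex code: one coordinate for each non-zero functional up to sign, repeated `s` times.
  let σ : C →ₗ[ZMod 3] Fin s × H → ZMod 3 :=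
    { toFun := fun x j => (j.2 : Dual (ZMod 3) C) x
      map_add' := fun x y => by ext; simp
      map_smul' := fun c x => by ext; simp }
  have hσ : ∀ x, x ≠ 0 → hammingNorm (σ x) = 3 ^ (m + 1) * s := by
    intro x hx
    have h1 := hH (fun f => f x ≠ 0) fun f => by simp
    have h2 : (Finset.univ.filter fun f : Dual (ZMod 3) C => f ≠ 0 ∧ f x ≠ 0) =
        Finset.univ.filter fun f : Dual (ZMod 3) C => f x ≠ 0 :=
      Finset.filter_congr fun f _ => and_iff_right_of_imp fun h h0 => h (by simp [h0])
    rw [h2, card_dual_apply_ne_zero hdim hx] at h1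
    have h3 : (H.filter fun f => f x ≠ 0).card = 3 ^ (m + 1) := by omega
    have h4 : hammingNorm (σ x) = ∑ i : Fin s, ∑ f : H, if (f : Dual (ZMod 3) C) x ≠ 0 then 1 else 0 := by
      rw [hammingNorm, Finset.card_filter, Fintype.sum_prod_type]
      rfl
    rw [h4, Finset.sum_coe_sort H fun f : Dual (ZMod 3) C => if f x ≠ 0 then 1 else 0,
      ← Finset.card_filter, h3]
    simp [mul_comm]
  have hself : ∀ x, σ x ⬝ᵥ σ x = 0 := by
    intro x
    rcases eq_or_ne x 0 with rfl | hx
    · simp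
    · rw [dotProduct_self_eq_hammingNorm, hσ x hx, ZMod.natCast_eq_zero_iff, pow_succ]
      exact Dvd.intro_left (3 ^ m * s) (by ring)
  -- Polarization again: all words are isotropic and 2 is invertible.
  have horth : ∀ x y, σ x ⬝ᵥ σ y = 0 := by
    intro x y
    have h1 := hself (x + y)
    rw [map_add, add_dotProduct, dotProduct_add, dotProduct_add, hself, hself,
      dotProduct_comm (σ y)] at h1
    generalize σ x ⬝ᵥ σ y = t at h1
    revert h1 t
    decide
  let φ : C →ₗ[ZMod 3] Fin n ⊕ Fin s × H → ZMod 3 :=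
    { toFun := fun x => Sum.elim x (σ x)
      map_add' := fun x y => by ext (i | i) <;> simp
      map_smul' := fun c x => by ext (i | i) <;> simp }
  have hφ : ∀ x ≠ 0, hammingNorm (φ x) = hammingNorm (x : Fin n → ZMod 3) + 3 ^ (m + 1) * s :=
    fun x hx => by rw [← hσ x hx]; exact hammingNorm_sumElim _ _
  refine existsLCDCode_of_linearMap φ ?_ hdim ?_ ?_ ?_
  · simp [hHcard, mul_comm]
  · rintro x hx
    rw [hφ x hx]
    exact Nat.add_le_add_right (hmin ⟨x, x.2, fun h => hx (Subtype.ext h), rfl⟩) _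
  · have hw : (⟨w, hwC⟩ : C) ≠ 0 := fun h => hw0 (congrArg Subtype.val h)
    exact ⟨⟨w, hwC⟩, hw, by rw [hφ _ hw, hwd]; rfl⟩
  · intro x hx
    refine Subtype.ext (hC.eq_zero x.2 fun y hy => ?_)
    have := hx ⟨y, hy⟩
    simpa only [φ, LinearMap.coe_mk, AddHom.coe_mk, sumElim_dotProduct_sumElim, horth, add_zero]
      using this

/-! ### Small combinations of vectors and the meet-in-the-middle weight bound. -/

/-- The sums of `v` with a combination, with coefficients `±1`, of at most `b` of the vectors
`c i`. -/
def signedSums {W : Type*} [AddCommGroup W] : (n : ℕ) → (Fin n → W) → ℕ → W → List W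
  | 0, _, _, v => [v]
  | _ + 1, _, 0, v => [v]
  | n + 1, c, b + 1, v => signedSums n (Fin.tail c) (b + 1) v ++
      (signedSums n (Fin.tail c) b (v + c 0) ++ signedSums n (Fin.tail c) b (v - c 0))

/-- The combinations, with coefficients `±1`, of at least one and at most `b + 1` of the vectors
`c i`, the first coefficient being `1`. -/
def monicSums {W : Type*} [AddCommGroup W] : (n : ℕ) → (Fin n → W) → ℕ → List W
  | 0, _, _ => []
  | n + 1, c, b => signedSums n (Fin.tail c) b (c 0) ++ monicSums n (Fin.tail c) b

/-- The first non-zero coordinate of `x` is `1`. -/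
def IsMonic : (n : ℕ) → (Fin n → ZMod 3) → Prop
  | 0, _ => False
  | n + 1, x => x 0 = 1 ∨ x 0 = 0 ∧ IsMonic n (Fin.tail x)

theorem hammingNorm_eq_tail {n : ℕ} (x : Fin (n + 1) → ZMod 3) :
    hammingNorm x = (if x 0 = 0 then 0 else 1) + hammingNorm (Fin.tail x) := by
  rw [hammingNorm_eq_sum, hammingNorm_eq_sum, Fin.sum_univ_succ]
  rfl

theorem isMonic_or_isMonic_neg : ∀ (n : ℕ) (x : Fin n → ZMod 3), x ≠ 0 →
    IsMonic n x ∨ IsMonic n (-x)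
  | 0, x, hx => (hx (Subsingleton.elim _ _)).elim
  | n + 1, x, hx => by
    have h3 : ∀ a : ZMod 3, a = 0 ∨ a = 1 ∨ -a = 1 := by decide
    rcases h3 (x 0) with h | h | h
    · have htail : Fin.tail x ≠ 0 := fun h0 => hx <| by
        rw [← Fin.cons_self_tail x, h, h0]
        ext i
        refine Fin.cases ?_ (fun _ => ?_) i <;> simp
      rcases isMonic_or_isMonic_neg n _ htail with h' | h'
      · exact Or.inl (Or.inr ⟨h, h'⟩)
      · exact Or.inr (Or.inr ⟨by simp [h], h'⟩)
    · exact Or.inl (Or.inl h)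
    · exact Or.inr (Or.inl h)

theorem hammingNorm_neg {ι F : Type*} [Fintype ι] [AddGroup F] [DecidableEq F] (x : ι → F) :
    hammingNorm (-x) = hammingNorm x := by
  simp [hammingNorm_eq_sum]

section

variable {W : Type*} [AddCommGroup W] [Module (ZMod 3) W]

theorem mem_signedSums : ∀ (n : ℕ) (c : Fin n → W) (b : ℕ) (v : W) (x : Fin n → ZMod 3),
    hammingNorm x ≤ b → v + ∑ i, x i • c i ∈ signedSums n c b v
  | 0, _, _, v, _, _ => by simp [signedSums]
  | _ + 1, _, 0, v, x, hx => by
    rw [Nat.le_zero, hammingNorm_eq_zero] at hx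
    simp [signedSums, hx]
  | n + 1, c, b + 1, v, x, hx => by
    have h3 : ∀ a : ZMod 3, a = 0 ∨ a = 1 ∨ a = -1 := by decide
    rw [hammingNorm_eq_tail] at hx
    rw [Fin.sum_univ_succ, ← add_assoc, signedSums, List.mem_append, List.mem_append]
    rcases h3 (x 0) with h | h | h <;> simp only [h] at hx ⊢
    · refine Or.inl ?_
      rw [zero_smul, add_zero]
      exact mem_signedSums n (Fin.tail c) _ _ (Fin.tail x) (by simpa using hx)
    · refine Or.inr (Or.inl ?_)
      rw [one_smul]
      refine mem_signedSums n (Fin.tail c) _ _ (Fin.tail x) ?_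
      simp at hx; omega
    · refine Or.inr (Or.inr ?_)
      rw [neg_one_smul, ← sub_eq_add_neg]
      refine mem_signedSums n (Fin.tail c) _ _ (Fin.tail x) ?_
      simp at hx; omega

theorem mem_monicSums : ∀ (n : ℕ) (c : Fin n → W) (b : ℕ) (x : Fin n → ZMod 3),
    IsMonic n x → hammingNorm x ≤ b + 1 → ∑ i, x i • c i ∈ monicSums n c b
  | n + 1, c, b, x, hx, hxb => by
    rw [hammingNorm_eq_tail] at hxb
    rw [Fin.sum_univ_succ, monicSums, List.mem_append]
    rcases hx with h | ⟨h, h'⟩ <;> simp only [h] at hxb ⊢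
    · rw [one_smul]
      refine Or.inl (mem_signedSums n (Fin.tail c) _ _ (Fin.tail x) ?_)
      simp at hxb; omega
    · rw [zero_smul, zero_add]
      exact Or.inr (mem_monicSums n (Fin.tail c) _ (Fin.tail x) h' (by simpa using hxb))

/-- The list is a concatenation over the three values of the first coefficient. Without repetitions
the pieces are disjoint, so equal keys force equal first coefficients, and induction treats the
tails. -/
theorem signedSums_injective {K : Type*} (key : W → K) : ∀ (n : ℕ) (c : Fin n → W) (b : ℕ) (v : W)
    (x y : Fin n → ZMod 3), ((signedSums n c b v).map key).Nodup →
    hammingNorm x ≤ b → hammingNorm y ≤ b →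
    key (v + ∑ i, x i • c i) = key (v + ∑ i, y i • c i) → x = y
  | 0, _, _, _, _, _, _, _, _, _ => Subsingleton.elim _ _
  | _ + 1, _, 0, v, x, y, _, hx, hy, _ => by
    rw [Nat.le_zero, hammingNorm_eq_zero] at hx hy
    rw [hx, hy]
  | n + 1, c, b + 1, v, x, y, hnd, hx, hy, hxy => by
    have h3 : ∀ a : ZMod 3, a = 0 ∨ a = 1 ∨ a = -1 := by decide
    rw [hammingNorm_eq_tail] at hx hy
    rw [Fin.sum_univ_succ, Fin.sum_univ_succ, ← add_assoc, ← add_assoc] at hxy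
    rw [signedSums, List.map_append, List.map_append, List.nodup_append', List.nodup_append'] at hnd
    obtain ⟨h0, ⟨h1, h2, h12⟩, h0'⟩ := hnd
    rw [List.disjoint_append_right] at h0'
    have cons : x 0 = y 0 → Fin.tail x = Fin.tail y → x = y := fun h h' => by
      rw [← Fin.cons_self_tail x, ← Fin.cons_self_tail y, h, h']
    have mem0 : ∀ z : Fin (n + 1) → ZMod 3, hammingNorm (Fin.tail z) ≤ b + 1 →
        key (v + ∑ i : Fin n, z i.succ • c i.succ) ∈
          (signedSums n (Fin.tail c) (b + 1) v).map key := fun z hz =>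
      List.mem_map_of_mem (mem_signedSums n (Fin.tail c) _ _ (Fin.tail z) hz)
    have mem1 : ∀ z : Fin (n + 1) → ZMod 3, ∀ u : W, hammingNorm (Fin.tail z) ≤ b →
        key (u + ∑ i : Fin n, z i.succ • c i.succ) ∈
          (signedSums n (Fin.tail c) b u).map key := fun z u hz =>
      List.mem_map_of_mem (mem_signedSums n (Fin.tail c) _ _ (Fin.tail z) hz)
    rcases h3 (x 0) with h | h | h <;> rcases h3 (y 0) with h' | h' | h' <;>
      simp only [h, h', zero_smul, one_smul, neg_one_smul, add_zero, ← sub_eq_add_neg, if_true,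
        zero_add, neg_eq_zero, one_ne_zero, if_false, Nat.add_comm 1,
        Nat.add_le_add_iff_right] at hx hy hxy
    · exact cons (h.trans h'.symm)
        (signedSums_injective key n (Fin.tail c) _ _ (Fin.tail x) (Fin.tail y) h0 hx hy hxy)
    · exact (h0'.1 (mem0 x hx) (hxy ▸ mem1 y _ hy)).elim
    · exact (h0'.2 (mem0 x hx) (hxy ▸ mem1 y _ hy)).elim
    · exact (h0'.1 (mem0 y hy) (hxy ▸ mem1 x _ hx)).elim
    · exact cons (h.trans h'.symm)
        (signedSums_injective key n (Fin.tail c) _ _ (Fin.tail x) (Fin.tail y) h1 hx hy hxy)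
    · exact (h12 (mem1 x _ hx) (hxy ▸ mem1 y _ hy)).elim
    · exact (h0'.2 (mem0 y hy) (hxy ▸ mem1 x _ hx)).elim
    · exact (h12 (mem1 y _ hy) (hxy ▸ mem1 x _ hx)).elim
    · exact cons (h.trans h'.symm)
        (signedSums_injective key n (Fin.tail c) _ _ (Fin.tail x) (Fin.tail y) h2 hx hy hxy)

theorem monicSums_injective {K : Type*} (key : W → K) : ∀ (n : ℕ) (c : Fin n → W) (b : ℕ)
    (x y : Fin n → ZMod 3), ((monicSums n c b).map key).Nodup → IsMonic n x → IsMonic n y →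
    hammingNorm x ≤ b + 1 → hammingNorm y ≤ b + 1 →
    key (∑ i, x i • c i) = key (∑ i, y i • c i) → x = y
  | n + 1, c, b, x, y, hnd, hx, hy, hxb, hyb, hxy => by
    rw [hammingNorm_eq_tail] at hxb hyb
    rw [Fin.sum_univ_succ, Fin.sum_univ_succ] at hxy
    rw [monicSums, List.map_append, List.nodup_append'] at hnd
    obtain ⟨h0, h1, h01⟩ := hnd
    have cons : x 0 = y 0 → Fin.tail x = Fin.tail y → x = y := fun h h' => by
      rw [← Fin.cons_self_tail x, ← Fin.cons_self_tail y, h, h']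
    have mem0 : ∀ z : Fin (n + 1) → ZMod 3, hammingNorm (Fin.tail z) ≤ b →
        key (c 0 + ∑ i : Fin n, z i.succ • c i.succ) ∈
          (signedSums n (Fin.tail c) b (c 0)).map key := fun z hz =>
      List.mem_map_of_mem (mem_signedSums n (Fin.tail c) _ _ (Fin.tail z) hz)
    have mem1 : ∀ z : Fin (n + 1) → ZMod 3, IsMonic n (Fin.tail z) →
        hammingNorm (Fin.tail z) ≤ b + 1 →
        key (∑ i : Fin n, z i.succ • c i.succ) ∈ (monicSums n (Fin.tail c) b).map key :=
      fun z hz hzb => List.mem_map_of_mem (mem_monicSums n (Fin.tail c) _ (Fin.tail z) hz hzb)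
    rcases hx with h | ⟨h, hx⟩ <;> rcases hy with h' | ⟨h', hy⟩ <;>
      simp only [h, h', zero_smul, one_smul, if_true, zero_add, one_ne_zero, if_false,
        Nat.add_comm 1, Nat.add_le_add_iff_right] at hxb hyb hxy
    · exact cons (h.trans h'.symm)
        (signedSums_injective key n (Fin.tail c) _ _ (Fin.tail x) (Fin.tail y) h0 hxb hyb hxy)
    · exact (h01 (mem0 x hxb) (hxy ▸ mem1 y hy hyb)).elim
    · exact (h01 (mem0 y hyb) (hxy ▸ mem1 x hx hxb)).elim
    · exact cons (h.trans h'.symm)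
        (monicSums_injective key n (Fin.tail c) _ (Fin.tail x) (Fin.tail y) h1 hx hy hxb hyb hxy)

theorem key_mem_monicSums {K : Type*} {key : W → K} (hkey : ∀ v, key (-v) = key v) {n : ℕ}
    {c : Fin n → W} {b : ℕ} {x : Fin n → ZMod 3} (hx : x ≠ 0)
    (hxb : hammingNorm x ≤ b + 1) : key (∑ i, x i • c i) ∈ (monicSums n c b).map key := by
  rcases isMonic_or_isMonic_neg n x hx with h | h
  · exact List.mem_map_of_mem (mem_monicSums n c b x h hxb)
  · rw [← hkey, ← Finset.sum_neg_distrib]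
    simp only [← neg_smul]
    exact List.mem_map_of_mem (mem_monicSums n c b (-x) h (by rwa [hammingNorm_neg]))

/-- With parity check columns for `c`, this bounds below the weights in the coset of syndrome `u`,
as construction X requires. -/
theorem sum_smul_ne_of_key_notMem {K : Type*} {key : W → K} (hkey : ∀ v, key (-v) = key v) {n : ℕ}
    {c : Fin n → W} {b : ℕ} {u : W} (hu : key u ∉ key 0 :: (monicSums n c b).map key)
    {x : Fin n → ZMod 3} (hx : ∑ i, x i • c i = u) : b + 1 < hammingNorm x := by
  by_contra! hxb
  rw [List.mem_cons, not_or] at hu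
  rcases eq_or_ne x 0 with rfl | hx0
  · simp only [Pi.zero_apply, zero_smul, Finset.sum_const_zero] at hx
    exact hu.1 (by rw [hx])
  · exact hu.2 (hx ▸ key_mem_monicSums hkey hx0 hxb)

/-- If the combinations of at most `b + 1` of the vectors `c i` are distinct up to sign, then no
`2 * (b + 1)` of these vectors are linearly dependent. -/
theorem lt_hammingNorm_of_nodup {K : Type*} {key : W → K} (hkey : ∀ v, key (-v) = key v) {n : ℕ}
    {c : Fin n → W} {b : ℕ} (hnd : (key 0 :: (monicSums n c b).map key).Nodup)
    {x : Fin n → ZMod 3} (hx0 : x ≠ 0) (hx : ∑ i, x i • c i = 0) :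
    2 * (b + 1) < hammingNorm x := by
  by_contra! hxb
  rw [List.nodup_cons] at hnd
  obtain ⟨hzero, hnd⟩ := hnd
  have hsmall : b + 1 < hammingNorm x := by
    by_contra! hle
    exact hzero (hx ▸ key_mem_monicSums hkey hx0 hle)
  -- Split `x` as `y + z` with disjoint supports, `y` of weight `b + 1` and `z` of weight between 1
  -- and `b + 1`. Their combinations are opposite, so their keys agree and `y = ±z`, which is
  -- absurd.
  obtain ⟨S, hS, hScard⟩ := Finset.exists_subset_card_eq (hsmall.le : b + 1 ≤ hammingNorm x)
  let y : Fin n → ZMod 3 := fun i => if i ∈ S then x i else 0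
  let z : Fin n → ZMod 3 := fun i => if i ∈ S then 0 else x i
  have hxS : ∀ i ∈ S, x i ≠ 0 := fun i hi => by simpa using hS hi
  have hy : hammingNorm y = b + 1 := by
    rw [hammingNorm, ← hScard]
    congr 1
    ext i
    simp only [y, Finset.mem_filter, Finset.mem_univ, true_and, ne_eq, ite_eq_right_iff, not_forall,
      exists_prop]
    exact and_iff_left_of_imp (hxS i)
  have hyz : hammingNorm y + hammingNorm z = hammingNorm x := by
    rw [hammingNorm_eq_sum, hammingNorm_eq_sum, hammingNorm_eq_sum, ← Finset.sum_add_distrib]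
    refine Finset.sum_congr rfl fun i _ => ?_
    by_cases hi : i ∈ S <;> simp [y, z, hi]
  have hsum : ∑ i, y i • c i = -∑ i, z i • c i := by
    rw [eq_neg_iff_add_eq_zero, ← Finset.sum_add_distrib, ← hx]
    refine Finset.sum_congr rfl fun i _ => ?_
    by_cases hi : i ∈ S <;> simp [y, z, hi]
  have hy0 : y ≠ 0 := by
    rw [← hammingNorm_ne_zero_iff]; omega
  have hz0 : z ≠ 0 := by
    rw [← hammingNorm_ne_zero_iff]; omega
  have hzb : hammingNorm z ≤ b + 1 := by omega
  have hkeyneg : ∀ t : Fin n → ZMod 3, key (∑ i, (-t) i • c i) = key (∑ i, t i • c i) := fun t => by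
    rw [← hkey (∑ i, t i • c i), ← Finset.sum_neg_distrib]
    simp
  have hyzkey : key (∑ i, y i • c i) = key (∑ i, z i • c i) := by rw [hsum, hkey]
  have hne : ∀ i, y i = 0 ∨ z i = 0 := fun i => by
    by_cases hi : i ∈ S <;> simp [y, z, hi]
  obtain ⟨i, hi⟩ : ∃ i, y i ≠ 0 := Function.ne_iff.1 hy0
  have hzi : z i = 0 := (hne i).resolve_left hi
  rcases isMonic_or_isMonic_neg n y hy0 with h | h <;>
    rcases isMonic_or_isMonic_neg n z hz0 with h' | h'
  · exact hi (by rw [monicSums_injective key n c b y z hnd h h' hy.le hzb hyzkey, hzi])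
  · exact hi (by rw [monicSums_injective key n c b y (-z) hnd h h' hy.le
      (by rwa [hammingNorm_neg]) (by rw [hkeyneg, hyzkey]), Pi.neg_apply, hzi, neg_zero])
  · exact hi (neg_eq_zero.1 (by rw [← Pi.neg_apply, monicSums_injective key n c b (-y) z hnd h h'
      (by rw [hammingNorm_neg, hy]) hzb (by rw [hkeyneg, hyzkey]), hzi]))
  · exact hi (neg_eq_zero.1 (by rw [← Pi.neg_apply, monicSums_injective key n c b (-y) (-z) hnd h h'
      (by rw [hammingNorm_neg, hy]) (by rwa [hammingNorm_neg])
      (by rw [hkeyneg, hkeyneg, hyzkey]), Pi.neg_apply, hzi, neg_zero]))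

end

/-! ### Binary encoding of ternary vectors and the test for repetitions. -/

/-- The number whose binary digits mark the coordinates `1` of `v`. -/
def posBits {r : ℕ} (v : Fin r → ZMod 3) : ℕ := Nat.ofBits fun i => decide (v i = 1)

/-- The number whose binary digits mark the coordinates `-1` of `v`. -/
def negBits {r : ℕ} (v : Fin r → ZMod 3) : ℕ := Nat.ofBits fun i => decide (v i = -1)

/-- The digits marking the coordinates `1` of a sum of two vectors over `ZMod 3`. -/
def addPos (p q p' q' : ℕ) : ℕ :=
  Nat.xor (Nat.lor q q') (Nat.xor (Nat.lor p q') (Nat.lor q p'))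

/-- The digits marking the coordinates `-1` of a sum of two vectors over `ZMod 3`. -/
def addNeg (p q p' q' : ℕ) : ℕ :=
  Nat.xor (Nat.lor p p') (Nat.xor (Nat.lor p q') (Nat.lor q p'))

theorem posBits_neg {r : ℕ} (v : Fin r → ZMod 3) : posBits (-v) = negBits v := by
  simp [posBits, negBits, neg_eq_iff_eq_neg]

theorem negBits_neg {r : ℕ} (v : Fin r → ZMod 3) : negBits (-v) = posBits v := by
  simp [posBits, negBits]

theorem posBits_add {r : ℕ} (v w : Fin r → ZMod 3) :
    posBits (v + w) = addPos (posBits v) (negBits v) (posBits w) (negBits w) := by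
  have h3 : ∀ a b : ZMod 3, decide (a + b = 1) = ((decide (a = -1) || decide (b = -1)) ^^
    ((decide (a = 1) || decide (b = -1)) ^^ (decide (a = -1) || decide (b = 1)))) := by decide
  refine Nat.eq_of_testBit_eq fun i => ?_
  change _ = (((negBits v ||| negBits w) ^^^ ((posBits v ||| negBits w) ^^^
    (negBits v ||| posBits w))).testBit i)
  simp only [Nat.testBit_xor, Nat.testBit_or]
  by_cases hi : i < r
  · simp only [posBits, negBits, Nat.testBit_ofBits_lt _ _ hi, Pi.add_apply, h3]
  · simp [posBits, negBits, Nat.testBit_ofBits_ge _ _ (not_lt.1 hi)]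

theorem negBits_add {r : ℕ} (v w : Fin r → ZMod 3) :
    negBits (v + w) = addNeg (posBits v) (negBits v) (posBits w) (negBits w) := by
  have h3 : ∀ a b : ZMod 3, decide (a + b = -1) = ((decide (a = 1) || decide (b = 1)) ^^
    ((decide (a = 1) || decide (b = -1)) ^^ (decide (a = -1) || decide (b = 1)))) := by decide
  refine Nat.eq_of_testBit_eq fun i => ?_
  change _ = (((posBits v ||| posBits w) ^^^ ((posBits v ||| negBits w) ^^^
    (negBits v ||| posBits w))).testBit i)
  simp only [Nat.testBit_xor, Nat.testBit_or]
  by_cases hi : i < r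
  · simp only [posBits, negBits, Nat.testBit_ofBits_lt _ _ hi, Pi.add_apply, h3]
  · simp [posBits, negBits, Nat.testBit_ofBits_ge _ _ (not_lt.1 hi)]

/-- A symmetric function of two numbers, injective on pairs of numbers below `2 ^ 16` up to
order. -/
noncomputable def pairKey (p q : ℕ) : ℕ :=
  Bool.rec (q + 65536 * p) (p + 65536 * q) (Nat.ble p q)

/-- Symmetry alone is needed for soundness: a collision of keys could only make the test fail. -/
theorem pairKey_comm (p q : ℕ) : pairKey p q = pairKey q p := by
  have h : ∀ p q, pairKey p q = if p ≤ q then p + 65536 * q else q + 65536 * p := fun p q => by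
    rw [pairKey]
    by_cases hpq : p ≤ q
    · rw [Nat.ble_eq_true_of_le hpq, if_pos hpq]
    · rw [Bool.eq_false_iff.2 fun h => hpq (Nat.le_of_ble_eq_true h), if_neg hpq]
  rw [h, h]
  split_ifs <;> omega

/-- The vectors `v` and `-v` have the same key. -/
noncomputable def ternaryKey {r : ℕ} (v : Fin r → ZMod 3) : ℕ := pairKey (posBits v) (negBits v)

theorem ternaryKey_neg {r : ℕ} (v : Fin r → ZMod 3) : ternaryKey (-v) = ternaryKey v := by
  rw [ternaryKey, posBits_neg, negBits_neg, pairKey_comm, ternaryKey]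

/-! The lists of keys of `signedSums` and `monicSums`, and a test for the absence of repetitions,
in a form suited to evaluation by the kernel. -/

/-- The keys of the list `signedSums`, followed by an accumulator. -/
noncomputable def signedKeys (l : List (ℕ × ℕ)) : ℕ → ℕ → ℕ → List ℕ → List ℕ :=
  List.rec (fun _ p q t => pairKey p q :: t)
    (fun c _ ih b => Nat.rec (fun p q t => pairKey p q :: t)
      (fun b' _ p q t => ih (Nat.succ b') p q (ih b' (addPos p q c.1 c.2) (addNeg p q c.1 c.2)
        (ih b' (addPos p q c.2 c.1) (addNeg p q c.2 c.1) t))) b) l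

/-- The keys of the list `monicSums`. -/
noncomputable def monicKeys (l : List (ℕ × ℕ)) (b : ℕ) : List ℕ :=
  List.rec [] (fun c l ih => signedKeys l b c.1 c.2 ih) l

theorem signedKeys_eq {r : ℕ} : ∀ (n : ℕ) (c : Fin n → Fin r → ZMod 3) (b : ℕ)
    (v : Fin r → ZMod 3) (t : List ℕ),
    signedKeys (List.ofFn fun i => (posBits (c i), negBits (c i))) b (posBits v) (negBits v) t =
      (signedSums n c b v).map ternaryKey ++ t
  | 0, _, _, _, _ => rfl
  | n + 1, c, 0, v, t => by rw [List.ofFn_succ]; rfl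
  | n + 1, c, b + 1, v, t => by
    have ih := signedKeys_eq n (Fin.tail c)
    have h1 := ih (b + 1) v
    have h2 := ih b (v + c 0)
    have h3 := ih b (v - c 0)
    rw [sub_eq_add_neg, posBits_add, negBits_add, posBits_neg, negBits_neg, ← sub_eq_add_neg] at h3
    rw [posBits_add, negBits_add] at h2
    rw [signedSums, List.map_append, List.map_append, List.append_assoc, List.append_assoc, ← h3,
      ← h2, ← h1, List.ofFn_succ]
    rfl

theorem monicKeys_eq {r : ℕ} : ∀ (n : ℕ) (c : Fin n → Fin r → ZMod 3) (b : ℕ),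
    monicKeys (List.ofFn fun i => (posBits (c i), negBits (c i))) b =
      (monicSums n c b).map ternaryKey
  | 0, _, _ => rfl
  | n + 1, c, b => by
    have ih := monicKeys_eq n (Fin.tail c) b
    have h := signedKeys_eq n (Fin.tail c) b (c 0) (monicKeys (List.ofFn fun i =>
      (posBits (Fin.tail c i), negBits (Fin.tail c i))) b)
    rw [monicSums, List.map_append, ← ih, ← h, List.ofFn_succ]
    rfl

/-- `split m l e o k` passes to `k` the elements of `l` without and with the bit `m`, put in front
of `e` and of `o`. -/
noncomputable def split (m : ℕ) (l : List ℕ) :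
    List ℕ → List ℕ → (List ℕ → List ℕ → Bool) → Bool :=
  List.rec (fun e o k => k e o)
    (fun x _ ih e o k =>
      Bool.rec (ih e (x :: o) k) (ih (x :: e) o k) (Nat.beq (Nat.land x m) 0)) l

/-- Tests that the residues modulo `M` of the elements of `l` are distinct, and not among the
bits of the accumulator. -/
noncomputable def hashDistinct (M : ℕ) (l : List ℕ) : ℕ → Bool :=
  List.rec (fun _ => true)
    (fun x _ ih m => Bool.rec false (ih (Nat.lor m (Nat.pow 2 (Nat.mod x M))))
      (Nat.beq (Nat.land m (Nat.pow 2 (Nat.mod x M))) 0)) l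

/-- Tests that the elements of `l` are distinct, by hashing and, where this fails, by splitting
according to a bit. -/
noncomputable def distinct (fuel : ℕ) : ℕ → List ℕ → Bool :=
  Nat.rec (fun _ _ => false)
    (fun _ ih m l => Bool.rec
      (split m l [] [] fun e o => Bool.rec false (ih (m * 2) o) (ih (m * 2) e)) true
      -- 65521 is the largest prime below 2^16. Any modulus is sound, since a collision of residues
      -- only leads to splitting.
      (hashDistinct 65521 l 0)) fuel

/-- The two classes differ in the value of the bit test, hence are disjoint, and each may be tested
alone. -/
theorem nodup_of_split {m : ℕ} {k : List ℕ → List ℕ → Bool}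
    (hk : ∀ e o, k e o = true → e.Nodup ∧ o.Nodup) : ∀ (l e o : List ℕ),
    (∀ x ∈ e, Nat.beq (Nat.land x m) 0 = true) → (∀ x ∈ o, Nat.beq (Nat.land x m) 0 = false) →
    split m l e o k = true → (l ++ (e ++ o)).Nodup
  | [], e, o, he, ho, h => by
    obtain ⟨h1, h2⟩ := hk e o h
    rw [List.nil_append]
    refine List.Nodup.append h1 h2 fun x hx hx' => ?_
    have := ho x hx'
    rw [he x hx] at this
    cases this
  | x :: l, e, o, he, ho, h => by
    change Bool.rec (split m l e (x :: o) k) (split m l (x :: e) o k)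
      (Nat.beq (Nat.land x m) 0) = true at h
    cases hx : Nat.beq (Nat.land x m) 0 <;> rw [hx] at h
    · have := nodup_of_split hk l e (x :: o) he (List.forall_mem_cons.2 ⟨hx, ho⟩) h
      refine (List.Perm.nodup_iff ?_).1 this
      rw [← List.append_assoc, List.cons_append, ← List.append_assoc]
      exact List.perm_middle
    · have := nodup_of_split hk l (x :: e) o (List.forall_mem_cons.2 ⟨hx, he⟩) ho h
      exact (List.Perm.nodup_iff List.perm_middle).1 this

theorem nodup_of_hashDistinct {M : ℕ} : ∀ (l : List ℕ) (m : ℕ), hashDistinct M l m = true →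
    l.Nodup ∧ ∀ x ∈ l, m.testBit (x % M) = false
  | [], _, _ => by simp
  | x :: l, m, h => by
    change Bool.rec false (hashDistinct M l (m ||| 2 ^ (x % M)))
      (Nat.beq (m &&& 2 ^ (x % M)) 0) = true at h
    cases hx : Nat.beq (m &&& 2 ^ (x % M)) 0 <;> rw [hx] at h
    · cases h
    · obtain ⟨h1, h2⟩ := nodup_of_hashDistinct l _ h
      simp only [Nat.testBit_or, Bool.or_eq_false_iff, Nat.testBit_two_pow,
        decide_eq_false_iff_not] at h2
      refine ⟨List.nodup_cons.2 ⟨fun hmem => (h2 x hmem).2 rfl, h1⟩,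
        List.forall_mem_cons.2 ⟨?_, fun y hy => (h2 y hy).1⟩⟩
      have h0 := congrArg (fun t => t.testBit (x % M)) (Nat.eq_of_beq_eq_true hx)
      simpa [Nat.testBit_and, Nat.testBit_two_pow] using h0

theorem nodup_of_distinct : ∀ (fuel m : ℕ) (l : List ℕ), distinct fuel m l = true → l.Nodup
  | 0, _, _, h => by cases h
  | n + 1, m, l, h => by
    change Bool.rec (split m l [] [] fun e o => Bool.rec false (distinct n (m * 2) o)
      (distinct n (m * 2) e)) true (hashDistinct 65521 l 0) = true at h
    cases hl : hashDistinct 65521 l 0 <;> rw [hl] at h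
    · have := nodup_of_split (m := m) (fun e o heo => ?_) l [] [] (by simp) (by simp) h
      · simpa using this
      · cases he : distinct n (m * 2) e <;> simp only [he] at heo
        · cases heo
        · exact ⟨nodup_of_distinct n _ e he, nodup_of_distinct n _ o heo⟩
    · exact (nodup_of_hashDistinct l 0 hl).1

/-! ### Systematic codes and their parity checks. -/

open Matrix

/-- The code with generator matrix `(1 | P)`. -/
def systematicCode {k r : ℕ} (P : Matrix (Fin k) (Fin r) (ZMod 3)) : LinearCode (ZMod 3) (k + r) where
  carrier := {x | ∃ a, Fin.append a (a ᵥ* P) = x}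
  add_mem' := by
    rintro _ _ ⟨a, rfl⟩ ⟨b, rfl⟩
    refine ⟨a + b, ?_⟩
    ext i
    refine Fin.addCases (fun i => ?_) (fun i => ?_) i <;> simp [add_vecMul]
  zero_mem' := by
    refine ⟨0, ?_⟩
    ext i
    refine Fin.addCases (fun i => ?_) (fun i => ?_) i <;> simp
  smul_mem' := by
    rintro c _ ⟨a, rfl⟩
    refine ⟨c • a, ?_⟩
    ext i
    refine Fin.addCases (fun i => ?_) (fun i => ?_) i <;> simp [smul_vecMul]

/-- The columns of the parity check matrix `(-Pᵀ | 1)`. -/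
def checkColumn {k r : ℕ} (P : Matrix (Fin k) (Fin r) (ZMod 3)) : Fin (k + r) → Fin r → ZMod 3 :=
  Fin.append (fun i => -P i) fun j => Pi.single j 1

section

variable {k r : ℕ} {P : Matrix (Fin k) (Fin r) (ZMod 3)}

theorem sum_append_smul_checkColumn (a : Fin k → ZMod 3) (z : Fin r → ZMod 3) :
    ∑ i, Fin.append a z i • checkColumn P i = z - a ᵥ* P := by
  rw [Fin.sum_univ_add]
  ext j
  simp [checkColumn, vecMul, dotProduct, Finset.sum_apply, Pi.single_apply]
  ring

theorem sum_smul_checkColumn_eq_zero {x : Fin (k + r) → ZMod 3} (hx : x ∈ systematicCode P) :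
    ∑ i, x i • checkColumn P i = 0 := by
  obtain ⟨a, rfl⟩ := hx
  rw [sum_append_smul_checkColumn, sub_self]

theorem append_dotProduct_append (a b : Fin k → ZMod 3) (y z : Fin r → ZMod 3) :
    Fin.append a y ⬝ᵥ Fin.append b z = a ⬝ᵥ b + y ⬝ᵥ z := by
  simp [dotProduct, Fin.sum_univ_add]

theorem finrank_systematicCode (P : Matrix (Fin k) (Fin r) (ZMod 3)) :
    finrank (ZMod 3) (systematicCode P) = k := by
  let e : systematicCode P ≃ₗ[ZMod 3] (Fin k → ZMod 3) := LinearEquiv.ofBijective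
    ((LinearMap.funLeft (ZMod 3) (ZMod 3) (Fin.castAdd r)).comp (systematicCode P).subtype) <| by
      refine ⟨?_, fun a => ⟨⟨_, a, rfl⟩, by ext; simp⟩⟩
      rintro ⟨_, a, rfl⟩ ⟨_, b, rfl⟩ h
      have : a = b := by
        ext i
        simpa using congrFun h i
      subst this
      rfl
  rw [e.finrank_eq, finrank_fin_fun]

theorem append_mem_dual (z : Fin r → ZMod 3) :
    Fin.append (-(P *ᵥ z)) z ∈ dual (systematicCode P) := by
  rintro _ ⟨a, rfl⟩
  change Fin.append _ _ ⬝ᵥ Fin.append _ _ = 0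
  rw [append_dotProduct_append, neg_dotProduct, dotProduct_comm z, ← dotProduct_mulVec,
    dotProduct_comm a, neg_add_cancel]

theorem eq_append_of_mem_dual {a : Fin k → ZMod 3} {z : Fin r → ZMod 3}
    (h : Fin.append a z ∈ dual (systematicCode P)) : a = -(P *ᵥ z) := by
  refine eq_neg_of_add_eq_zero_left (dotProduct_eq_zero _ fun b => ?_)
  have := h _ ⟨b, rfl⟩
  change Fin.append _ _ ⬝ᵥ Fin.append _ _ = 0 at this
  rwa [append_dotProduct_append, dotProduct_comm z, ← dotProduct_mulVec, dotProduct_comm b,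
    ← add_dotProduct] at this

variable {V : Matrix (Fin r) (Fin r) (ZMod 3)}

/-- With H = (-Pᵀ | 1), the matrix inverted by `V` is HHᵀ. A word in the code and its dual has the
form Hᵀz with HHᵀz = 0, so z = 0. -/
theorem isLCD_systematicCode (hV : V * (1 + Pᵀ * P) = 1) : IsLCD (systematicCode P) := by
  rw [IsLCD, eq_bot_iff]
  rintro _ ⟨⟨a, rfl⟩, h⟩
  have ha := eq_append_of_mem_dual h
  have hz : (1 + Pᵀ * P) *ᵥ (a ᵥ* P) = 0 := by
    rw [add_mulVec, one_mulVec, ← mulVec_mulVec, ← neg_neg (P *ᵥ (a ᵥ* P)), ← ha, mulVec_neg,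
      mulVec_transpose, add_neg_cancel]
  have hz' : a ᵥ* P = 0 := by
    rw [← one_mulVec (a ᵥ* P), ← hV, ← mulVec_mulVec, hz, mulVec_zero]
  rw [hz', mulVec_zero, neg_zero] at ha
  subst ha
  rw [Submodule.mem_bot, hz']
  ext i
  refine Fin.addCases (fun i => ?_) (fun i => ?_) i <;> simp

/-- A systematic code whose parity check columns have distinct small combinations is LCD with the
given parameters, and so is its enlargement by construction X with the dual vector of syndrome
`u`. -/
theorem existsLCDCode_systematic {b : ℕ} (hb : b ≤ 2) (u : Fin r → ZMod 3) (a : Fin k → ZMod 3)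
    (l : List (ℕ × ℕ))
    (hl : (List.ofFn fun i => (posBits (checkColumn P i), negBits (checkColumn P i))) = l)
    (hdistinct : distinct 32 1 (pairKey (posBits u) (negBits u) :: 0 :: monicKeys l b) = true)
    (hV : V * (1 + Pᵀ * P) = 1) (hu : u ⬝ᵥ (V *ᵥ u) ≠ 0)
    (ha : hammingNorm (Fin.append a (a ᵥ* P)) = 2 * b + 3) :
    ExistsLCDCode (ZMod 3) (k + r) k (2 * b + 3) ∧
      ExistsLCDCode (ZMod 3) (k + r + 3) (k + 1) (2 * b + 3) := by
  have hzero : ternaryKey (0 : Fin r → ZMod 3) = 0 := by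
    have hbits : Nat.ofBits (fun _ : Fin r => false) = 0 :=
      Nat.eq_of_testBit_eq fun i => by
        rcases lt_or_ge i r with hi | hi
        · simp [Nat.testBit_ofBits_lt _ _ hi]
        · simp [Nat.testBit_ofBits_ge _ _ hi]
    have h1 : posBits (0 : Fin r → ZMod 3) = 0 := by simpa [posBits] using hbits
    have h2 : negBits (0 : Fin r → ZMod 3) = 0 := by simpa [negBits] using hbits
    rw [ternaryKey, h1, h2]
    rfl
  have hnd := nodup_of_distinct _ _ _ hdistinct
  rw [← hl, monicKeys_eq, ← hzero, ← ternaryKey, List.nodup_cons] at hnd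
  obtain ⟨hukey, hnd⟩ := hnd
  have hmin : HasMinWeight (systematicCode P) (2 * b + 3) := by
    refine ⟨⟨_, ⟨a, rfl⟩, fun h => ?_, ha.symm⟩, ?_⟩
    · rw [h, hammingNorm_zero] at ha
      omega
    · rintro _ ⟨x, hx, hx0, rfl⟩
      exact lt_hammingNorm_of_nodup ternaryKey_neg hnd hx0 (sum_smul_checkColumn_eq_zero hx)
  have hlcd := isLCD_systematicCode hV
  refine ⟨⟨_, finrank_systematicCode P, hmin, hlcd⟩, ?_⟩
  have hV' : (1 + Pᵀ * P) *ᵥ (V *ᵥ u) = u := by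
    rw [mulVec_mulVec, mul_eq_one_comm.1 hV, one_mulVec]
  have hV'' : V *ᵥ u + (P *ᵥ (V *ᵥ u)) ᵥ* P = u := by
    rwa [add_mulVec, one_mulVec, ← mulVec_mulVec, mulVec_transpose] at hV'
  -- The adjoined vector is w = HᵀVu, of syndrome HHᵀVu = u and with w·w = u·Vu.
  refine existsLCDCode_constructionX (finrank_systematicCode P) hmin hlcd
    (append_mem_dual (V *ᵥ u)) ?_ fun x hx => ?_
  · rw [append_dotProduct_append, neg_dotProduct_neg, dotProduct_mulVec, ← add_dotProduct,
      add_comm, hV'']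
    exact hu
  · have := sum_smul_ne_of_key_notMem ternaryKey_neg hukey (x := x + Fin.append _ _) (by
      simp only [Pi.add_apply, add_smul, Finset.sum_add_distrib, sum_smul_checkColumn_eq_zero hx,
        zero_add]
      rw [sum_append_smul_checkColumn, neg_vecMul, sub_neg_eq_add, hV''])
    -- The coset has weights at least b + 2, and b + 2 + 3 ≥ 2b + 3 exactly because b ≤ 2.
    omega

end

/-! ### The two explicit codes. -/

/-- The redundancy part of a systematic generator matrix of a ternary `[34, 22, 7]` code. -/
def redundancy34 : Matrix (Fin 22) (Fin 12) (ZMod 3) :=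
  !![2, 2, 2, 0, 0, 1, 0, 1, 2, 0, 2, 1;
    1, 2, 1, 2, 2, 1, 1, 0, 1, 1, 2, 0;
    2, 1, 0, 0, 2, 0, 0, 1, 1, 1, 1, 0;
    1, 0, 0, 2, 1, 1, 1, 1, 1, 0, 1, 2;
    0, 1, 1, 1, 1, 0, 2, 1, 2, 2, 1, 2;
    2, 2, 0, 0, 1, 1, 2, 0, 2, 1, 0, 0;
    0, 2, 2, 0, 0, 0, 0, 1, 1, 1, 0, 2;
    0, 0, 2, 0, 1, 2, 1, 1, 1, 0, 0, 1;
    1, 0, 0, 1, 2, 1, 1, 0, 1, 2, 2, 1;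
    0, 2, 0, 0, 2, 0, 1, 0, 2, 0, 1, 2;
    2, 1, 2, 0, 1, 0, 2, 2, 0, 1, 2, 1;
    2, 0, 0, 1, 2, 2, 2, 1, 0, 2, 1, 0;
    2, 0, 2, 2, 0, 0, 1, 2, 2, 0, 2, 0;
    2, 1, 2, 0, 2, 0, 1, 0, 2, 0, 0, 1;
    2, 0, 2, 0, 0, 1, 1, 0, 1, 0, 1, 1;
    0, 1, 1, 2, 2, 0, 2, 1, 0, 1, 1, 0;
    1, 2, 0, 1, 0, 1, 0, 0, 0, 1, 2, 2;
    1, 2, 2, 2, 1, 1, 0, 0, 0, 0, 1, 0;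
    2, 2, 1, 1, 1, 0, 0, 0, 2, 0, 0, 1;
    1, 2, 2, 2, 2, 2, 0, 2, 1, 2, 0, 1;
    0, 1, 0, 2, 2, 1, 2, 1, 1, 1, 0, 2;
    0, 0, 2, 0, 2, 1, 1, 2, 0, 1, 2, 2]

/-- The inverse of the Gram matrix of the parity check matrix. -/
def gramInv34 : Matrix (Fin 12) (Fin 12) (ZMod 3) :=
  !![2, 0, 1, 0, 1, 2, 2, 2, 0, 0, 2, 0;
    0, 2, 2, 0, 2, 2, 2, 0, 1, 0, 0, 2;
    1, 2, 0, 2, 2, 0, 1, 2, 0, 1, 2, 0;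
    0, 0, 2, 0, 2, 2, 1, 0, 1, 1, 0, 2;
    1, 2, 2, 2, 2, 2, 1, 0, 0, 1, 1, 2;
    2, 2, 0, 2, 2, 2, 1, 2, 1, 0, 2, 1;
    2, 2, 1, 1, 1, 1, 1, 1, 2, 1, 2, 2;
    2, 0, 2, 0, 0, 2, 1, 2, 1, 1, 2, 2;
    0, 1, 0, 1, 0, 1, 2, 1, 2, 2, 1, 0;
    0, 0, 1, 1, 1, 0, 1, 1, 2, 0, 0, 0;
    2, 0, 2, 0, 1, 2, 2, 2, 1, 0, 2, 1;
    0, 2, 0, 2, 2, 1, 2, 2, 0, 0, 1, 2]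

/-- The Gram matrix of the parity check matrix. -/
def gram34 : Matrix (Fin 12) (Fin 12) (ZMod 3) :=
  !![1, 2, 0, 0, 2, 2, 0, 2, 1, 1, 2, 1;
    2, 1, 2, 0, 1, 0, 2, 2, 1, 0, 0, 0;
    0, 2, 0, 0, 0, 2, 1, 0, 1, 2, 0, 2;
    0, 0, 0, 1, 2, 1, 1, 1, 2, 2, 2, 1;
    2, 1, 0, 2, 0, 0, 0, 0, 2, 2, 1, 1;
    2, 0, 2, 1, 0, 2, 0, 1, 1, 0, 0, 0;
    0, 2, 1, 1, 0, 0, 1, 0, 0, 2, 0, 2;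
    2, 2, 0, 1, 0, 1, 0, 2, 0, 1, 1, 0;
    1, 1, 1, 2, 2, 1, 0, 0, 2, 2, 1, 0;
    1, 0, 2, 2, 2, 0, 2, 1, 2, 2, 0, 2;
    2, 0, 0, 2, 1, 0, 0, 1, 1, 0, 1, 0;
    1, 0, 2, 1, 1, 0, 2, 0, 0, 2, 0, 1]

/-- The syndrome of the vector used in construction X. -/
def syndrome34 : Fin 12 → ZMod 3 := ![0, 1, 0, 0, 0, 2, 2, 0, 1, 2, 0, 1]

/-- The information part of a word of weight `7`. -/
def minWord34 : Fin 22 → ZMod 3 :=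
  ![0, 0, 0, 0, 0, 0, 1, 0, 0, 0, 0, 0, 0, 0, 0, 0, 0, 0, 0, 0, 0, 0]

/-- The columns of the parity check matrix in binary encoding. -/
def checkBits34 : List (ℕ × ℕ) :=
  [(1287, 2208), (1050, 869), (17, 1922), (2056, 1521), (2880, 1182), (323, 560), (2054, 896),
    (36, 2512), (1552, 2409), (2322, 1088), (1221, 2578), (625, 1160), (1421, 64), (277, 2114),
    (5, 3424), (88, 1670), (3074, 553), (14, 1073), (259, 2076), (702, 2305), (2136, 930),
    (3220, 608), (1, 0), (2, 0), (4, 0), (8, 0), (16, 0), (32, 0), (64, 0), (128, 0), (256, 0),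
    (512, 0), (1024, 0), (2048, 0)]

theorem gramInv34_mul : gramInv34 * (1 + redundancy34ᵀ * redundancy34) = 1 := by
  have h : 1 + redundancy34ᵀ * redundancy34 = gram34 := by decide +kernel
  rw [h]
  decide +kernel

set_option maxRecDepth 100000 in
theorem distinct_checkBits34 :
    distinct 32 1 (pairKey (posBits syndrome34) (negBits syndrome34) :: 0 ::
      monicKeys checkBits34 2) = true := by
  decide +kernel

theorem existsLCDCode_34 : ExistsLCDCode (ZMod 3) 34 22 7 ∧
    ExistsLCDCode (ZMod 3) 37 23 7 :=
  -- 7 = 2·2 + 3, so combinations of up to three columns are compared. `minWord34` is a unit vector: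
  -- a row of the generator matrix already has weight 7.
  existsLCDCode_systematic (P := redundancy34) (V := gramInv34) (b := 2) (by norm_num)
    syndrome34 minWord34 checkBits34 (by decide +kernel) distinct_checkBits34 gramInv34_mul
    (by decide +kernel) (by decide +kernel)

/-- The redundancy part of a systematic generator matrix of a ternary `[37, 29, 5]` code. -/
def redundancy37 : Matrix (Fin 29) (Fin 8) (ZMod 3) :=
  !![0, 1, 0, 0, 2, 2, 2, 2;
    0, 0, 1, 2, 1, 0, 1, 1;
    2, 2, 1, 1, 1, 2, 0, 1;
    2, 2, 1, 0, 0, 1, 0, 0;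
    0, 1, 2, 0, 1, 1, 1, 0;
    2, 1, 2, 1, 1, 1, 1, 1;
    1, 2, 2, 2, 1, 1, 1, 0;
    0, 0, 1, 2, 0, 2, 2, 0;
    2, 1, 0, 2, 0, 1, 1, 2;
    0, 0, 0, 2, 1, 1, 2, 2;
    1, 2, 1, 0, 0, 2, 0, 1;
    0, 2, 1, 2, 1, 2, 0, 2;
    1, 1, 0, 2, 2, 1, 1, 1;
    1, 2, 0, 0, 2, 2, 1, 0;
    0, 2, 1, 2, 0, 0, 2, 1;
    2, 0, 2, 1, 0, 0, 1, 1;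
    0, 0, 2, 2, 2, 1, 1, 2;
    1, 0, 1, 2, 0, 1, 0, 0;
    0, 1, 2, 0, 1, 0, 2, 1;
    0, 0, 2, 0, 2, 2, 1, 0;
    0, 1, 2, 2, 1, 2, 2, 2;
    2, 0, 2, 0, 2, 0, 0, 1;
    2, 1, 1, 2, 1, 0, 2, 2;
    1, 2, 0, 2, 2, 0, 2, 1;
    1, 1, 1, 0, 2, 0, 2, 1;
    0, 2, 2, 2, 1, 0, 0, 0;
    1, 0, 1, 0, 2, 1, 1, 2;
    1, 0, 0, 1, 1, 2, 2, 0;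
    1, 0, 0, 1, 0, 1, 2, 2]

/-- The inverse of the Gram matrix of the parity check matrix. -/
def gramInv37 : Matrix (Fin 8) (Fin 8) (ZMod 3) :=
  !![2, 0, 0, 0, 0, 1, 1, 2;
    0, 0, 2, 1, 2, 2, 1, 2;
    0, 2, 0, 2, 1, 1, 2, 2;
    0, 1, 2, 2, 0, 1, 0, 2;
    0, 2, 1, 0, 0, 0, 0, 1;
    1, 2, 1, 1, 0, 2, 0, 2;
    1, 1, 2, 0, 0, 0, 0, 2;
    2, 2, 2, 2, 1, 2, 2, 2]

/-- The Gram matrix of the parity check matrix. -/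
def gram37 : Matrix (Fin 8) (Fin 8) (ZMod 3) :=
  !![0, 0, 0, 0, 1, 0, 1, 0;
    0, 1, 1, 1, 0, 1, 2, 0;
    0, 1, 1, 0, 2, 0, 0, 0;
    0, 1, 0, 2, 2, 0, 1, 1;
    1, 0, 2, 2, 1, 0, 0, 2;
    0, 1, 0, 0, 0, 0, 1, 1;
    1, 2, 0, 1, 0, 1, 2, 2;
    0, 0, 0, 1, 2, 1, 2, 0]

/-- The syndrome of the vector used in construction X. -/
def syndrome37 : Fin 8 → ZMod 3 := ![2, 0, 2, 0, 1, 1, 2, 0]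

/-- The information part of a word of weight `5`. -/
def minWord37 : Fin 29 → ZMod 3 :=
  ![0, 0, 0, 1, 0, 0, 0, 0, 0, 0, 0, 0, 0, 0, 0, 0, 0, 0, 0, 0, 0, 0, 0, 0, 0, 0, 0, 0, 0]

/-- The columns of the parity check matrix in binary encoding. -/
def checkBits37 : List (ℕ × ℕ) :=
  [(240, 2), (8, 212), (35, 156), (3, 36), (4, 114), (5, 250), (14, 113), (104, 4), (137, 98),
    (200, 48), (34, 133), (170, 20), (24, 227), (50, 65), (74, 132), (5, 200), (156, 96), (8,
    37), (68, 146), (52, 64), (236, 18), (21, 128), (201, 22), (90, 129), (80, 135), (14, 16),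
    (144, 101), (96, 25), (192, 41), (1, 0), (2, 0), (4, 0), (8, 0), (16, 0), (32, 0), (64, 0),
    (128, 0)]

theorem gramInv37_mul : gramInv37 * (1 + redundancy37ᵀ * redundancy37) = 1 := by
  have h : 1 + redundancy37ᵀ * redundancy37 = gram37 := by decide +kernel
  rw [h]
  decide +kernel

set_option maxRecDepth 100000 in
theorem distinct_checkBits37 :
    distinct 32 1 (pairKey (posBits syndrome37) (negBits syndrome37) :: 0 ::
      monicKeys checkBits37 1) = true := by
  decide +kernel

theorem existsLCDCode_37 : ExistsLCDCode (ZMod 3) 37 29 5 ∧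
    ExistsLCDCode (ZMod 3) 40 30 5 :=
  -- 5 = 2·1 + 3, so combinations of at most two columns suffice.
  existsLCDCode_systematic (P := redundancy37) (V := gramInv37) (b := 1) (by norm_num)
    syndrome37 minWord37 checkBits37 (by decide +kernel) distinct_checkBits37 gramInv37_mul
    (by decide +kernel) (by decide +kernel)

end LCDCode

theorem mainTheorem11 (n k d : ℕ) (h : (n, k, d) ∈ LCDCode.P3 ∪ LCDCode.P3') (s : ℕ) :
    LCDCode.ExistsLCDCode (ZMod 3) (n + (3 ^ k - 1) / 2 * s) k (d + 3 ^ (k - 1) * s) := by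
  simp only [LCDCode.P3, LCDCode.P3', Finset.mem_union, Finset.mem_insert, Finset.mem_singleton,
    Prod.mk.injEq] at h
  rcases h with (⟨rfl, rfl, rfl⟩ | ⟨rfl, rfl, rfl⟩ | ⟨rfl, rfl, rfl⟩ | ⟨rfl, rfl, rfl⟩) |
    ⟨rfl, rfl, rfl⟩ | ⟨rfl, rfl, rfl⟩ | ⟨rfl, rfl, rfl⟩ | ⟨rfl, rfl, rfl⟩
  · exact LCDCode.existsLCDCode_34.1.add_simplex (by norm_num) s
  · exact LCDCode.existsLCDCode_34.2.add_simplex (by norm_num) s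
  · exact LCDCode.existsLCDCode_37.1.add_simplex (by norm_num) s
  · exact LCDCode.existsLCDCode_37.2.add_simplex (by norm_num) s
  · exact (LCDCode.existsLCDCode_34.1.pred (by norm_num) (by norm_num)).add_simplex (by norm_num) s
  · exact (LCDCode.existsLCDCode_34.2.pred (by norm_num) (by norm_num)).add_simplex (by norm_num) s
  · exact (LCDCode.existsLCDCode_37.1.pred (by norm_num) (by norm_num)).add_simplex (by norm_num) s
  · exact (LCDCode.existsLCDCode_37.2.pred (by norm_num) (by norm_num)).add_simplex (by norm_num) s
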